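/- Let $\mathsf R$ be the theory of classical first-order predicate logic with identity, in the language with $0,\mathsf S,+,\times,<$, axiomatised by the following sentences, where $\underline n$ is the unary numeral $\mathsf S\cdots\mathsf S0$ of $n$ and $m,n$ range over the natural numbers: (1) $\underline m+\underline n=\underline{m+n}$; (2) $\underline m\times\underline n=\underline{mn}$; (3) $\underline m\neq\underline n$, for $m\neq n$; (4) $\forall x\,(x<\underline n\to\bigvee_{i<n}x=\underline i)$; (5) $\forall x\,(x<\underline n\vee x=\underline n\vee\underline n<x)$. The theorems of a theory are the sentences derivable from it in classical first-order logic; equivalently, by Gödel's completeness theorem, the sentences true in all its models. A theory is consistent if $\bot$ is not a theorem. Call a theory RE if it is given by a recursively enumerable set of axioms, and undecidable if its set of theorems is not recursive. A theory $V$ is an extension of $U$, and $U$ is a sub-theory of $V$, if both are in the same language and every theorem of $U$ is a theorem of $V$. A theory is hereditarily undecidable if all its consistent RE sub-theories are undecidable, and essentially hereditarily undecidable if all its consistent RE extensions are hereditarily undecidable. Theorem (Cobham). The theory $\mathsf R$ is RE, consistent and essentially hereditarily undecidable. -/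

import Mathlib

namespace CobhamR

open FirstOrder FirstOrder.Language

/-! ### Gödel numbering of the sentences of a language with enumerated symbols -/

section Coding

variable {L : FirstOrder.Language.{0, 0}} [∀ k, Encodable (L.Functions k)]

/-- Gödel number of a term whose variables are the bound variables `0, …, n - 1`. -/
def termCode {n : ℕ} : L.Term (Empty ⊕ Fin n) → ℕ
  | .var (.inl e) => e.elim
  | .var (.inr i) => 2 * (i : ℕ)
  | .func (l := k) f ts =>
      2 * Nat.pair k (Nat.pair (Encodable.encode f)
        (Encodable.encode (List.ofFn fun i => termCode (ts i)))) + 1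

theorem termCode_injective {n : ℕ} :
    Function.Injective (termCode : L.Term (Empty ⊕ Fin n) → ℕ) := by
  intro t
  induction t with
  | var x =>
    rcases x with e | i
    · exact e.elim
    · intro u h
      rcases u with (e | j) | ⟨g, us⟩
      · exact e.elim
      · simp only [termCode] at h
        have : i = j := Fin.ext (by omega)
        rw [this]
      · simp only [termCode] at h
        omega
  | @func k f ts ih =>
    intro u h
    rcases u with (e | j) | @⟨k', g, us⟩
    · exact e.elim
    · simp only [termCode] at h
      omega
    · simp only [termCode] at h
      have h' := Nat.pair_eq_pair.1 (Nat.eq_of_mul_eq_mul_left two_pos (Nat.succ.inj h))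
      obtain ⟨rfl, h2⟩ := h'
      obtain ⟨h3, h4⟩ := Nat.pair_eq_pair.1 h2
      obtain rfl := Encodable.encode_injective h3
      have h5 := List.ofFn_injective (Encodable.encode_injective h4)
      have : ts = us := funext fun i => ih i (congrFun h5 i)
      rw [this]

variable [∀ k, Encodable (L.Relations k)]

/-- Gödel number of a formula whose free variables are among `0, …, n - 1`. -/
def formulaCode : {n : ℕ} → L.BoundedFormula Empty n → ℕ
  | _, .falsum => 0
  | _, .equal t u => 4 * Nat.pair (termCode t) (termCode u) + 1
  | _, .rel (l := k) R ts =>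
      4 * Nat.pair k (Nat.pair (Encodable.encode R)
        (Encodable.encode (List.ofFn fun i => termCode (ts i)))) + 2
  | _, .imp φ ψ => 4 * Nat.pair (formulaCode φ) (formulaCode ψ) + 3
  | _, .all φ => 4 * formulaCode φ + 4

/-- Distinct formulas have distinct Gödel numbers. -/
theorem formulaCode_injective {n : ℕ} :
    Function.Injective (formulaCode : L.BoundedFormula Empty n → ℕ) := by
  intro φ
  induction φ with
  | falsum =>
    intro ψ h
    cases ψ <;> simp only [formulaCode] at h <;> first | rfl | omega
  | equal t u =>
    intro ψ h
    cases ψ <;> simp only [formulaCode] at h <;> try omega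
    obtain ⟨h1, h2⟩ := Nat.pair_eq_pair.1
      (Nat.eq_of_mul_eq_mul_left (show 0 < 4 by norm_num) (Nat.add_right_cancel h))
    rw [termCode_injective h1, termCode_injective h2]
  | rel R ts =>
    intro ψ h
    cases ψ <;> simp only [formulaCode] at h <;> try omega
    have h0 := Nat.eq_of_mul_eq_mul_left (show 0 < 4 by norm_num) (Nat.add_right_cancel h)
    obtain ⟨rfl, h2⟩ := Nat.pair_eq_pair.1 h0
    obtain ⟨h3, h4⟩ := Nat.pair_eq_pair.1 h2
    obtain rfl := Encodable.encode_injective h3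
    have h5 := List.ofFn_injective (Encodable.encode_injective h4)
    congr 1
    exact funext fun i => termCode_injective (congrFun h5 i)
  | imp φ₁ φ₂ ih₁ ih₂ =>
    intro ψ h
    cases ψ <;> simp only [formulaCode] at h <;> try omega
    obtain ⟨h1, h2⟩ := Nat.pair_eq_pair.1
      (Nat.eq_of_mul_eq_mul_left (show 0 < 4 by norm_num) (Nat.add_right_cancel h))
    rw [ih₁ h1, ih₂ h2]
  | all φ ih =>
    intro ψ h
    cases ψ <;> simp only [formulaCode] at h <;> try omega
    rw [ih (Nat.eq_of_mul_eq_mul_left (show 0 < 4 by norm_num) (Nat.add_right_cancel h))]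

/-! ### Theories

A theory is presented by a set of axioms (`L.Theory` is `Set L.Sentence`).  Its theorems are the
sentences that follow from it in classical first-order logic, in Mathlib's sense `T ⊨ᵇ φ`: `φ` holds
in every (nonempty) model of `T`. -/

/-- The set of theorems of `T`. -/
def theoremsOf (T : L.Theory) : Set L.Sentence := {φ | T ⊨ᵇ φ}

/-- `T` is consistent: falsum is not a theorem. -/
def Consistent (T : L.Theory) : Prop := (⊥ : L.Sentence) ∉ theoremsOf T

/-- `U ⊆ₑ V`: every theorem of `U` is a theorem of `V`. -/
def SubTheory (U V : L.Theory) : Prop := theoremsOf U ⊆ theoremsOf V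

/-- The axiom set of `T` is recursively enumerable. -/
def RE (T : L.Theory) : Prop := REPred fun n : ℕ => ∃ φ : L.Sentence, φ ∈ T ∧ formulaCode φ = n

/-- The set of theorems of `T` is not recursive. -/
def Undecidable (T : L.Theory) : Prop :=
  ¬ ComputablePred fun n : ℕ => ∃ φ : L.Sentence, φ ∈ theoremsOf T ∧ formulaCode φ = n

/-- `U` is essentially `P`: all consistent RE extensions of `U` in the same language are `P`. -/
def Essentially (P : L.Theory → Prop) (U : L.Theory) : Prop :=
  ∀ V : L.Theory, RE V → Consistent V → SubTheory U V → P V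

/-- `U` is hereditarily `P`: all consistent RE sub-theories of `U` in the same language are `P`. -/
def Hereditarily (P : L.Theory → Prop) (U : L.Theory) : Prop :=
  ∀ W : L.Theory, RE W → Consistent W → SubTheory W U → P W

end Coding

/-! ### The arithmetical language and the theory `R` -/

/-- Function symbols `0`, `S`, `+`, `×`. -/
inductive ArithFunc : ℕ → Type
  | zero : ArithFunc 0
  | succ : ArithFunc 1
  | add : ArithFunc 2
  | mul : ArithFunc 2

/-- Relation symbol `<`. -/
inductive ArithRel : ℕ → Type
  | lt : ArithRel 2

/-- The arithmetical language with `0`, `S`, `+`, `×` and `<`. -/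
def arith : FirstOrder.Language.{0, 0} := ⟨ArithFunc, ArithRel⟩

instance instEncodableFunctions : ∀ k, Encodable (arith.Functions k)
  | 0 => ⟨fun _ => 0, fun _ => some ArithFunc.zero, by rintro ⟨⟩; rfl⟩
  | 1 => ⟨fun _ => 0, fun _ => some ArithFunc.succ, by rintro ⟨⟩; rfl⟩
  | 2 => ⟨fun f => match f with
            | ArithFunc.add => 0
            | ArithFunc.mul => 1,
          fun n => match n with
            | 0 => some ArithFunc.add
            | _ => some ArithFunc.mul,
          by rintro ⟨⟩ <;> rfl⟩
  | _ + 3 => ⟨fun _ => 0, fun _ => none, by rintro ⟨⟩⟩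

instance instEncodableRelations : ∀ k, Encodable (arith.Relations k)
  | 0 => ⟨fun _ => 0, fun _ => none, by rintro ⟨⟩⟩
  | 1 => ⟨fun _ => 0, fun _ => none, by rintro ⟨⟩⟩
  | 2 => ⟨fun _ => 0, fun _ => some ArithRel.lt, by rintro ⟨⟩; rfl⟩
  | _ + 3 => ⟨fun _ => 0, fun _ => none, by rintro ⟨⟩⟩

section Arithmetic

variable {α : Type}

def addT (t u : arith.Term α) : arith.Term α := Functions.apply₂ (L := arith) ArithFunc.add t u

def mulT (t u : arith.Term α) : arith.Term α := Functions.apply₂ (L := arith) ArithFunc.mul t u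

/-- The numeral `S ⋯ S 0` with `n` occurrences of `S`. -/
def numeral : ℕ → arith.Term α
  | 0 => Constants.term (L := arith) ArithFunc.zero
  | n + 1 => Functions.apply₁ (L := arith) ArithFunc.succ (numeral n)

/-- The formula `t < u`. -/
def ltF {n : ℕ} (t u : arith.Term (Empty ⊕ Fin n)) : arith.BoundedFormula Empty n :=
  Relations.boundedFormula₂ (L := arith) ArithRel.lt t u

/-- The disjunction of the formulas `t = i` (with `i` a numeral) over all `i < n`; it is falsum for
`n = 0`. -/
def eqNumeralBelow {m : ℕ} (t : arith.Term (Empty ⊕ Fin m)) : ℕ → arith.BoundedFormula Empty m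
  | 0 => ⊥
  | n + 1 => eqNumeralBelow t n ⊔ t.bdEqual (numeral n)

/-- The variable bound by the outermost quantifier. -/
def x0 : arith.Term (Empty ⊕ Fin 1) := Term.var (Sum.inr 0)

/-- `m + n = m+n` on numerals. -/
def axR1 (m n : ℕ) : arith.Sentence :=
  Term.bdEqual (addT (numeral m) (numeral n)) (numeral (m + n))

/-- `m × n = mn` on numerals. -/
def axR2 (m n : ℕ) : arith.Sentence :=
  Term.bdEqual (mulT (numeral m) (numeral n)) (numeral (m * n))

/-- `m ≠ n` on numerals. -/
def axR3 (m n : ℕ) : arith.Sentence :=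
  (Term.bdEqual (numeral m) (numeral n)).not

/-- `∀ x, x < n → ⋁_{i < n} x = i`. -/
def axR4 (n : ℕ) : arith.Sentence :=
  ((ltF x0 (numeral n)).imp (eqNumeralBelow x0 n)).all

/-- `∀ x, x < n ∨ x = n ∨ n < x`. -/
def axR5 (n : ℕ) : arith.Sentence :=
  (ltF x0 (numeral n) ⊔ (x0.bdEqual (numeral n) ⊔ ltF (numeral n) x0)).all

/-- The Tarski–Mostowski–Robinson theory `R`, in the language with `<`. -/
def R : arith.Theory :=
  {φ | (∃ m n, φ = axR1 m n) ∨ (∃ m n, φ = axR2 m n) ∨ (∃ m n, m ≠ n ∧ φ = axR3 m n) ∨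
    (∃ n, φ = axR4 n) ∨ (∃ n, φ = axR5 n)}

end Arithmetic

end CobhamR

/-!
The argument is Vaught's. It needs neither the recursive enumerability of the extension `V` of `R`
nor that of the sub-theory `W` of `V`: only that `V` is consistent, that is, has a model, which is
then a model of both `R` and `W`.

Take a partial recursive `f` for which no recursive set separates `{n | f n = 1}` from
`{n | f n = 0}` (`exists_partrec_inseparable`). It is enough to find sentences `χ n` with computable
Gödel numbers (`primrec_formulaCode_sepSentence`) such that `χ n` is valid in pure logic if
`f n = 1`, and false in all models of `R` if `f n = 0` (`exists_sepSentence`). For then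
`{n | W ⊢ χ n}` separates the two sets, and it would be recursive if `W` were decidable.

The sentence `χ n` denies that there is a *certified* `b` above `n` such that some `x < b` witnesses
`f n = 0` and none witnesses `f n = 1`, where all quantifiers are bounded by `b`. "Certified"
(`Certified`) is a finite list of conditions saying that `0`, `S`, `+`, `×` and `<` behave below `b`
as on the natural numbers. In a model of `R` every positive numeral is certified and bounds a copy
of an initial segment of `ℕ`; so if `f n = 0`, any large enough numeral refutes `χ n`. In an
arbitrary structure, the segment below a certified `b` is either a finite initial segment of `ℕ`,
and then a witness of `f n = 0` below `b` is a true one, or it contains any given initial segment of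
`ℕ`, and then it contains the witness of `f n = 1` if there is one
(`Certified.segment_or_stdSegment`). So if `f n = 1`, then `χ n` holds in all structures, whether or
not they satisfy any arithmetic.

The bounded formulas come from `SigmaDef`, a notion of definability which has these two transfer
properties built in. It contains the graphs of `+`, `×` and `<` and is closed under positive
connectives, existential quantification and bounded universal quantification; Gödel's `β`-function
then gives all partial recursive functions (`SigmaDef.of_partrec`).
-/

namespace CobhamR

open FirstOrder FirstOrder.Language

/-! ### Numerals and initial segments of structures for the arithmetical language -/

section Segments

variable {M : Type} [arith.Structure M]

/-- The interpretation of the symbol `S`. -/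
def succM (x : M) : M := Structure.funMap (L := arith) ArithFunc.succ ![x]

/-- The interpretation of the symbol `+`. -/
def addM (x y : M) : M := Structure.funMap (L := arith) ArithFunc.add ![x, y]

/-- The interpretation of the symbol `×`. -/
def mulM (x y : M) : M := Structure.funMap (L := arith) ArithFunc.mul ![x, y]

/-- The interpretation of the symbol `<`. -/
def ltM (x y : M) : Prop := Structure.RelMap (L := arith) ArithRel.lt ![x, y]

variable (M) in
/-- The value of the numeral of `n` in `M`. -/
def num : ℕ → M
  | 0 => Structure.funMap (L := arith) ArithFunc.zero ![]
  | n + 1 => succM (num n)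

variable {α : Type}

@[simp]
theorem realize_addT (t u : arith.Term α) (v : α → M) :
    (addT t u).realize v = addM (t.realize v) (u.realize v) :=
  Term.realize_functions_apply₂

@[simp]
theorem realize_mulT (t u : arith.Term α) (v : α → M) :
    (mulT t u).realize v = mulM (t.realize v) (u.realize v) :=
  Term.realize_functions_apply₂

/-- The term `S t`. -/
def succT (t : arith.Term α) : arith.Term α :=
  Functions.apply₁ (L := arith) ArithFunc.succ t

@[simp]
theorem realize_succT (t : arith.Term α) (v : α → M) :
    (succT t).realize v = succM (t.realize v) :=
  Term.realize_functions_apply₁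

@[simp]
theorem realize_numeral (n : ℕ) (v : α → M) : (numeral n : arith.Term α).realize v = num M n := by
  induction n with
  | zero =>
    exact congrArg (Structure.funMap (L := arith) (n := 0) ArithFunc.zero)
      (Subsingleton.elim (α := Fin 0 → M) _ _)
  | succ n ih => exact (realize_succT (numeral n) v).trans (congrArg succM ih)

/-- The formula `t < u`, with an arbitrary type of free variables. -/
def ltB {n : ℕ} (t u : arith.Term (α ⊕ Fin n)) : arith.BoundedFormula α n :=
  Relations.boundedFormula₂ (L := arith) ArithRel.lt t u

@[simp]
theorem realize_ltB {n : ℕ} (t u : arith.Term (α ⊕ Fin n)) (v : α → M) (xs : Fin n → M) :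
    (ltB t u).Realize v xs ↔ ltM (t.realize (Sum.elim v xs)) (u.realize (Sum.elim v xs)) :=
  BoundedFormula.realize_rel₂

@[simp]
theorem realize_ltF {n : ℕ} (t u : arith.Term (Empty ⊕ Fin n)) (v : Empty → M) (xs : Fin n → M) :
    (ltF t u).Realize v xs ↔ ltM (t.realize (Sum.elim v xs)) (u.realize (Sum.elim v xs)) :=
  BoundedFormula.realize_rel₂

/-- The elements below `b` begin with the numerals of the numbers below `k`, on which `+`, `×` and
`<` take their true values as long as these stay below `k`. -/
structure Segment (b : M) (k : ℕ) : Prop where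
  lt_bound : ∀ i < k, ltM (num M i) b
  add : ∀ i j, i + j < k → addM (num M i) (num M j) = num M (i + j)
  mul : ∀ i j, i < k → j < k → i * j < k → mulM (num M i) (num M j) = num M (i * j)
  lt : ∀ i j, i < j → j < k → ltM (num M i) (num M j)
  eq_num : ∀ j < k, ∀ y : M, ltM y b → ltM y (num M j) → ∃ i < j, y = num M i

/-- The elements below `b` are exactly the numerals of the numbers below `k`, and the partial
structure on them is that of `{0, …, k - 1}`. -/
structure StdSegment (b : M) (k : ℕ) : Prop extends Segment b k where
  surj : ∀ y : M, ltM y b → ∃ i < k, y = num M i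
  add_reflect : ∀ i < k, ∀ j < k, ∀ l < k, addM (num M i) (num M j) = num M l → i + j = l
  mul_reflect : ∀ i < k, ∀ j < k, ∀ l < k, mulM (num M i) (num M j) = num M l → i * j = l
  lt_reflect : ∀ i < k, ∀ j < k, ltM (num M i) (num M j) → i < j

theorem Segment.mono {b : M} {k l : ℕ} (h : Segment b l) (hkl : k ≤ l) : Segment b k where
  lt_bound i hi := h.lt_bound i (hi.trans_le hkl)
  add i j hij := h.add i j (hij.trans_le hkl)
  mul i j hi hj hij := h.mul i j (hi.trans_le hkl) (hj.trans_le hkl) (hij.trans_le hkl)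
  lt i j hij hj := h.lt i j hij (hj.trans_le hkl)
  eq_num j hj := h.eq_num j (hj.trans_le hkl)

end Segments

/-! ### Relations defined by formulas bounded by an element -/

/-- The relation `P` on numbers is defined by a formula `φ` with a parameter `b` that bounds all
quantifiers, in the following sense: if `P v`, then `φ` holds of the numerals of `v` in every
structure whose segment below `b` is long enough; and if `φ` holds of them in a structure where the
segment below `b` is standard, then `P v`. The free variable of `φ` of type `Unit` stands for
`b`. -/
def SigmaDef {n : ℕ} (P : (Fin n → ℕ) → Prop) : Prop :=
  ∃ φ : arith.BoundedFormula Unit n,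
    (∀ v, P v → ∃ k, ∀ (M : Type) [arith.Structure M] (b : M), Segment b k →
      φ.Realize (fun _ => b) (num M ∘ v)) ∧
    (∀ (M : Type) [arith.Structure M] (b : M) (k : ℕ), StdSegment b k → ∀ v : Fin n → ℕ,
      (∀ i, v i < k) → φ.Realize (fun _ => b) (num M ∘ v) → P v)

namespace SigmaDef

variable {n m : ℕ}

theorem of_iff {P Q : (Fin n → ℕ) → Prop} (h : SigmaDef P) (e : ∀ v, Q v ↔ P v) : SigmaDef Q :=
  (funext fun v => propext (e v) : Q = P) ▸ h

theorem and {P Q : (Fin n → ℕ) → Prop} (hP : SigmaDef P) (hQ : SigmaDef Q) :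
    SigmaDef fun v => P v ∧ Q v := by
  obtain ⟨φ, hφ, hφ'⟩ := hP
  obtain ⟨ψ, hψ, hψ'⟩ := hQ
  refine ⟨φ ⊓ ψ, fun v hv => ?_, fun M _ b k hb v hv h => ?_⟩
  · obtain ⟨k, hk⟩ := hφ v hv.1
    obtain ⟨l, hl⟩ := hψ v hv.2
    exact ⟨max k l, fun M _ b hb => BoundedFormula.realize_inf.2
      ⟨hk M b (hb.mono (le_max_left _ _)), hl M b (hb.mono (le_max_right _ _))⟩⟩
  · have h := BoundedFormula.realize_inf.1 h
    exact ⟨hφ' M b k hb v hv h.1, hψ' M b k hb v hv h.2⟩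

theorem or {P Q : (Fin n → ℕ) → Prop} (hP : SigmaDef P) (hQ : SigmaDef Q) :
    SigmaDef fun v => P v ∨ Q v := by
  obtain ⟨φ, hφ, hφ'⟩ := hP
  obtain ⟨ψ, hψ, hψ'⟩ := hQ
  refine ⟨φ ⊔ ψ, fun v hv => ?_, fun M _ b k hb v hv h => ?_⟩
  · rcases hv with hv | hv
    · obtain ⟨k, hk⟩ := hφ v hv
      exact ⟨k, fun M _ b hb => BoundedFormula.realize_sup.2 (Or.inl (hk M b hb))⟩
    · obtain ⟨k, hk⟩ := hψ v hv
      exact ⟨k, fun M _ b hb => BoundedFormula.realize_sup.2 (Or.inr (hk M b hb))⟩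
  · exact (BoundedFormula.realize_sup.1 h).imp (hφ' M b k hb v hv) (hψ' M b k hb v hv)

theorem ex {Q : (Fin n → ℕ) → ℕ → Prop}
    (hQ : SigmaDef fun w : Fin (n + 1) → ℕ => Q (Fin.init w) (w (Fin.last n))) :
    SigmaDef fun v => ∃ x, Q v x := by
  obtain ⟨φ, hφ, hφ'⟩ := hQ
  refine ⟨(ltB (Term.var (Sum.inr (Fin.last n))) (Term.var (Sum.inl ())) ⊓ φ).ex,
    fun v ⟨x, hx⟩ => ?_, fun M _ b k hb v hv h => ?_⟩
  · obtain ⟨k, hk⟩ := hφ (Fin.snoc v x) (by simpa using hx)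
    refine ⟨max k (x + 1), fun M _ b hb => BoundedFormula.realize_ex.2 ⟨num M x, ?_⟩⟩
    have := hk M b (hb.mono (le_max_left _ _))
    rw [Fin.comp_snoc] at this
    simpa [this] using hb.lt_bound x (by simp)
  · obtain ⟨y, hy⟩ := BoundedFormula.realize_ex.1 h
    simp only [BoundedFormula.realize_inf, realize_ltB, Term.realize_var, Sum.elim_inr,
      Fin.snoc_last, Sum.elim_inl] at hy
    obtain ⟨x, hx, rfl⟩ := hb.surj y hy.1
    have := hφ' M b k hb (Fin.snoc v x)
      (fun i => by refine Fin.lastCases ?_ (fun i => ?_) i <;> simp [hx, hv])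
      (by rw [Fin.comp_snoc]; exact hy.2)
    exact ⟨x, by simpa using this⟩

theorem ball {Q : (Fin n → ℕ) → ℕ → Prop} (i : Fin n)
    (hQ : SigmaDef fun w : Fin (n + 1) → ℕ => Q (Fin.init w) (w (Fin.last n))) :
    SigmaDef fun v => ∀ x < v i, Q v x := by
  obtain ⟨φ, hφ, hφ'⟩ := hQ
  refine ⟨((ltB (Term.var (Sum.inr (Fin.last n))) (Term.var (Sum.inl ()))).imp
      ((ltB (Term.var (Sum.inr (Fin.last n))) (Term.var (Sum.inr i.castSucc))).imp φ)).all,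
    fun v hv => ?_, fun M _ b k hb v hv h x hx => ?_⟩
  · have h (x : ℕ) : ∃ k, x < v i → ∀ (M : Type) [arith.Structure M] (b : M), Segment b k →
        φ.Realize (fun _ => b) (num M ∘ (Fin.snoc v x : Fin (n + 1) → ℕ)) := by
      by_cases hx : x < v i
      · obtain ⟨k, hk⟩ := hφ (Fin.snoc v x) (by simpa using hv x hx)
        exact ⟨k, fun _ => hk⟩
      · exact ⟨0, fun h => absurd h hx⟩
    choose k hk using h
    refine ⟨max (v i + 1) ((Finset.range (v i)).sup k), fun M _ b hb =>
      BoundedFormula.realize_all.2 fun y => ?_⟩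
    simp only [BoundedFormula.realize_imp, realize_ltB, Term.realize_var, Sum.elim_inr,
      Fin.snoc_last, Sum.elim_inl, Fin.snoc_castSucc, Function.comp_apply]
    intro hyb hy
    obtain ⟨x, hx, rfl⟩ := hb.eq_num (v i) (by simp) y hyb hy
    have := hk x hx M b (hb.mono
      ((Finset.le_sup (f := k) (Finset.mem_range.2 hx)).trans (le_max_right _ _)))
    rwa [Fin.comp_snoc] at this
  · have hxk : x < k := hx.trans (hv i)
    have h := BoundedFormula.realize_all.1 h (num M x)
    simp only [BoundedFormula.realize_imp, realize_ltB, Term.realize_var, Sum.elim_inr,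
      Fin.snoc_last, Sum.elim_inl, Fin.snoc_castSucc, Function.comp_apply] at h
    have := hφ' M b k hb (Fin.snoc v x)
      (fun i => by refine Fin.lastCases ?_ (fun i => ?_) i <;> simp [hxk, hv])
      (by rw [Fin.comp_snoc]; exact h (hb.lt_bound x hxk) (hb.lt x (v i) hx (hv i)))
    simpa using this

theorem reindex {P : (Fin n → ℕ) → Prop} (hP : SigmaDef P) (ρ : Fin n → Fin m) :
    SigmaDef fun v : Fin m → ℕ => P (v ∘ ρ) := by
  obtain ⟨φ, hφ, hφ'⟩ := hP
  let ψ : arith.BoundedFormula Unit m :=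
    BoundedFormula.relabel (n := m) (k := 0) (Sum.map id ρ : Unit ⊕ Fin n → Unit ⊕ Fin m)
      φ.toFormula
  have hψ (M : Type) [arith.Structure M] (b : M) (xs : Fin m → M) :
      ψ.Realize (fun _ => b) xs ↔ φ.Realize (fun _ => b) (xs ∘ ρ) := by
    refine (BoundedFormula.realize_relabel (m := m) (n := 0) (xs := xs)).trans ?_
    rw [Subsingleton.elim (xs ∘ Fin.natAdd m : Fin 0 → M) default]
    exact BoundedFormula.realize_toFormula φ _
  refine ⟨ψ, fun v hv => ?_, fun M _ b k hb v hv h => ?_⟩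
  · obtain ⟨k, hk⟩ := hφ _ hv
    exact ⟨k, fun M _ b hb => (hψ M b _).2 (hk M b hb)⟩
  · exact hφ' M b k hb _ (fun i => hv (ρ i)) ((hψ M b _).1 h)

theorem add_graph (i j l : Fin n) : SigmaDef fun v : Fin n → ℕ => v i + v j = v l := by
  refine ⟨(addT (Term.var (Sum.inr i)) (Term.var (Sum.inr j))).bdEqual (Term.var (Sum.inr l)),
    fun v hv => ⟨v l + 1, fun M _ b hb => ?_⟩, fun M _ b k hb v hv h => ?_⟩
  · simpa [← hv] using hb.add (v i) (v j) (by omega)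
  · exact hb.add_reflect _ (hv i) _ (hv j) _ (hv l) (by simpa using h)

theorem mul_graph (i j l : Fin n) : SigmaDef fun v : Fin n → ℕ => v i * v j = v l := by
  refine ⟨(mulT (Term.var (Sum.inr i)) (Term.var (Sum.inr j))).bdEqual (Term.var (Sum.inr l)),
    fun v hv => ⟨v i + v j + v l + 1, fun M _ b hb => ?_⟩, fun M _ b k hb v hv h => ?_⟩
  · simpa [← hv] using hb.mul (v i) (v j) (by omega) (by omega) (by omega)
  · exact hb.mul_reflect _ (hv i) _ (hv j) _ (hv l) (by simpa using h)

theorem lt_vars (i j : Fin n) : SigmaDef fun v : Fin n → ℕ => v i < v j := by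
  refine ⟨ltB (Term.var (Sum.inr i)) (Term.var (Sum.inr j)),
    fun v hv => ⟨v j + 1, fun M _ b hb => ?_⟩, fun M _ b k hb v hv h => ?_⟩
  · simpa using hb.lt (v i) (v j) hv (by omega)
  · exact hb.lt_reflect _ (hv i) _ (hv j) (by simpa using h)

end SigmaDef

/-! ### Definability of the graphs of partial recursive functions -/

/-- The graph of `f` is defined by a bounded formula in the sense of `SigmaDef`. The value is the
last variable. -/
def SigmaFun {n : ℕ} (f : (Fin n → ℕ) → ℕ) : Prop :=
  SigmaDef fun w : Fin (n + 1) → ℕ => f (Fin.init w) = w (Fin.last n)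

section

variable {n : ℕ} {f g h : (Fin n → ℕ) → ℕ}

/-- Insertion of a dummy variable before the last one. -/
theorem SigmaDef.weaken {Q : (Fin n → ℕ) → ℕ → Prop}
    (hQ : SigmaDef fun w : Fin (n + 1) → ℕ => Q (Fin.init w) (w (Fin.last n))) :
    SigmaDef fun w : Fin (n + 2) → ℕ => Q (Fin.init (Fin.init w)) (w (Fin.last (n + 1))) :=
  (hQ.reindex (Fin.snoc (fun i => i.castSucc.castSucc) (Fin.last (n + 1)))).of_iff fun w => by
    have : Fin.init (w ∘ (Fin.snoc (fun i => i.castSucc.castSucc) (Fin.last (n + 1)) :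
        Fin (n + 1) → Fin (n + 2))) = Fin.init (Fin.init w) := by
      funext i
      simp [Fin.init]
    simp [this]

theorem SigmaFun.init (hf : SigmaFun f) :
    SigmaFun fun v : Fin (n + 1) → ℕ => f (Fin.init v) :=
  SigmaDef.weaken (Q := fun v x => f v = x) hf

theorem SigmaFun.bind {Q : (Fin n → ℕ) → ℕ → Prop} (hf : SigmaFun f)
    (hQ : SigmaDef fun w : Fin (n + 1) → ℕ => Q (Fin.init w) (w (Fin.last n))) :
    SigmaDef fun v => Q v (f v) :=
  (SigmaDef.ex (Q := fun v x => f v = x ∧ Q v x) (SigmaDef.and hf hQ)).of_iff fun v => by simp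

theorem SigmaDef.comp₃ {r : ℕ → ℕ → ℕ → Prop}
    (hr : SigmaDef fun v : Fin 3 → ℕ => r (v 0) (v 1) (v 2))
    (hf : SigmaFun f) (hg : SigmaFun g) (hh : SigmaFun h) :
    SigmaDef fun v => r (f v) (g v) (h v) :=
  hf.bind (Q := fun v x => r x (g v) (h v)) <|
    hg.init.bind (Q := fun w y => r (w (Fin.last n)) y (h (Fin.init w))) <|
      hh.init.init.bind
        (Q := fun w z => r (w (Fin.last n).castSucc) (w (Fin.last (n + 1))) z) <|
        hr.reindex ![(Fin.last n).castSucc.castSucc, (Fin.last (n + 1)).castSucc,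
          Fin.last (n + 2)]

theorem SigmaDef.comp₂ {r : ℕ → ℕ → Prop} (hr : SigmaDef fun v : Fin 2 → ℕ => r (v 0) (v 1))
    (hf : SigmaFun f) (hg : SigmaFun g) : SigmaDef fun v => r (f v) (g v) :=
  SigmaDef.comp₃ (r := fun x y _ => r x y) (hr.reindex ![0, 1]) hf hg hg

theorem SigmaDef.ball_lt {Q : (Fin n → ℕ) → ℕ → Prop} (hf : SigmaFun f)
    (hQ : SigmaDef fun w : Fin (n + 1) → ℕ => Q (Fin.init w) (w (Fin.last n))) :
    SigmaDef fun v => ∀ x < f v, Q v x :=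
  hf.bind (Q := fun v y => ∀ x < y, Q v x) <|
    SigmaDef.ball (Q := fun w x => Q (Fin.init w) x) (Fin.last n) hQ.weaken

/-- The number `0` is the only solution of `x + x = x`. -/
theorem SigmaDef.var_eq_zero (i : Fin n) : SigmaDef fun v : Fin n → ℕ => v i = 0 :=
  (SigmaDef.add_graph i i i).of_iff fun v => by omega

theorem SigmaDef.var_eq_var (i j : Fin n) : SigmaDef fun v : Fin n → ℕ => v i = v j :=
  (SigmaDef.ex (Q := fun v z => z = 0 ∧ v i + z = v j)
    ((var_eq_zero (Fin.last n)).and (add_graph i.castSucc (Fin.last n) j.castSucc))).of_iff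
    fun v => by simp

/-- The number `1` is the only positive solution of `x * x = x`. -/
theorem SigmaDef.var_eq_one (i : Fin n) : SigmaDef fun v : Fin n → ℕ => v i = 1 :=
  (SigmaDef.ex (Q := fun v z => z < v i ∧ v i * v i = v i)
    ((lt_vars (Fin.last n) i.castSucc).and
      (mul_graph i.castSucc i.castSucc i.castSucc))).of_iff fun v => by
    constructor
    · intro h
      exact ⟨0, by simp [h]⟩
    · rintro ⟨z, hz, h⟩
      exact Nat.eq_of_mul_eq_mul_left ((Nat.zero_le z).trans_lt hz) (by simpa using h)

namespace SigmaFun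

theorem var (i : Fin n) : SigmaFun fun v : Fin n → ℕ => v i :=
  SigmaDef.var_eq_var i.castSucc (Fin.last n)

theorem zero : SigmaFun fun _ : Fin n → ℕ => 0 :=
  (SigmaDef.var_eq_zero (Fin.last n)).of_iff fun _ => eq_comm

theorem one : SigmaFun fun _ : Fin n → ℕ => 1 :=
  (SigmaDef.var_eq_one (Fin.last n)).of_iff fun _ => eq_comm

theorem add (hf : SigmaFun f) (hg : SigmaFun g) : SigmaFun fun v => f v + g v :=
  SigmaDef.comp₃ (r := fun x y z => x + y = z) (SigmaDef.add_graph 0 1 2)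
    hf.init hg.init (var (Fin.last n))

theorem mul (hf : SigmaFun f) (hg : SigmaFun g) : SigmaFun fun v => f v * g v :=
  SigmaDef.comp₃ (r := fun x y z => x * y = z) (SigmaDef.mul_graph 0 1 2)
    hf.init hg.init (var (Fin.last n))

end SigmaFun

theorem SigmaDef.eq (hf : SigmaFun f) (hg : SigmaFun g) : SigmaDef fun v => f v = g v :=
  SigmaDef.comp₂ (r := fun x y => x = y) (SigmaDef.var_eq_var 0 1) hf hg

theorem SigmaDef.lt (hf : SigmaFun f) (hg : SigmaFun g) : SigmaDef fun v => f v < g v :=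
  SigmaDef.comp₂ (r := fun x y => x < y) (SigmaDef.lt_vars 0 1) hf hg

namespace SigmaFun

theorem pair (hf : SigmaFun f) (hg : SigmaFun g) : SigmaFun fun v => Nat.pair (f v) (g v) := by
  have h : SigmaDef fun v : Fin 3 → ℕ => Nat.pair (v 0) (v 1) = v 2 := by
    have h1 := (SigmaDef.lt (var (n := 3) 0) (var 1)).and
      (SigmaDef.eq (((var (n := 3) 1).mul (var 1)).add (var 0)) (var 2))
    have h2 := (SigmaDef.lt (var (n := 3) 1) ((var 0).add one)).and
      (SigmaDef.eq ((((var (n := 3) 0).mul (var 0)).add (var 0)).add (var 1)) (var 2))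
    refine (h1.or h2).of_iff fun v => ?_
    unfold Nat.pair
    split_ifs <;> omega
  exact SigmaDef.comp₃ (r := fun x y z => Nat.pair x y = z) h hf.init hg.init (var (Fin.last n))

theorem unpair_fst (hf : SigmaFun f) : SigmaFun fun v => (f v).unpair.1 := by
  have h : SigmaDef fun v : Fin 2 → ℕ => (v 0).unpair.1 = v 1 :=
    (SigmaDef.ex (Q := fun v z => v 0 = Nat.pair (v 1) z)
      (SigmaDef.eq (var (n := 3) 0) (pair (var 1) (var 2)))).of_iff fun v => by
      constructor
      · intro h
        exact ⟨(v 0).unpair.2, by rw [← h, Nat.pair_unpair]⟩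
      · rintro ⟨z, hz⟩
        rw [hz, Nat.unpair_pair]
  exact SigmaDef.comp₂ (r := fun x y => x.unpair.1 = y) h hf.init (var (Fin.last n))

theorem unpair_snd (hf : SigmaFun f) : SigmaFun fun v => (f v).unpair.2 := by
  have h : SigmaDef fun v : Fin 2 → ℕ => (v 0).unpair.2 = v 1 :=
    (SigmaDef.ex (Q := fun v z => v 0 = Nat.pair z (v 1))
      (SigmaDef.eq (var (n := 3) 0) (pair (var 2) (var 1)))).of_iff fun v => by
      constructor
      · intro h
        exact ⟨(v 0).unpair.1, by rw [← h, Nat.pair_unpair]⟩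
      · rintro ⟨z, hz⟩
        rw [hz, Nat.unpair_pair]
  exact SigmaDef.comp₂ (r := fun x y => x.unpair.2 = y) h hf.init (var (Fin.last n))

theorem mod_succ (hf : SigmaFun f) (hg : SigmaFun g) : SigmaFun fun v => f v % (g v + 1) := by
  have h : SigmaDef fun v : Fin 3 → ℕ => v 0 % (v 1 + 1) = v 2 :=
    (SigmaDef.ex (Q := fun v d => v 2 < v 1 + 1 ∧ v 0 = (v 1 + 1) * d + v 2)
      ((SigmaDef.lt (var (n := 4) 2) ((var 1).add one)).and
        (SigmaDef.eq (var 0) ((((var 1).add one).mul (var 3)).add (var 2))))).of_iff fun v => by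
      constructor
      · intro h
        exact ⟨v 0 / (v 1 + 1), h ▸ Nat.mod_lt _ (Nat.succ_pos _),
          by rw [← h, Nat.div_add_mod]⟩
      · rintro ⟨d, hlt, hd⟩
        rw [hd, Nat.mul_add_mod, Nat.mod_eq_of_lt hlt]
  exact SigmaDef.comp₃ (r := fun x y z => x % (y + 1) = z) h hf.init hg.init (var (Fin.last n))

theorem beta (hf : SigmaFun f) (hg : SigmaFun g) : SigmaFun fun v => Nat.beta (f v) (g v) :=
  hf.unpair_fst.mod_succ ((hg.add one).mul hf.unpair_snd)

end SigmaFun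

end

/-- A value of a recursion is witnessed by a code of the sequence of the intermediate values. -/
theorem mem_rec_iff_beta (a : Part ℕ) (s : ℕ → ℕ → Part ℕ) (n m : ℕ) :
    m ∈ (Nat.rec a (fun y IH => IH.bind (s y)) n : Part ℕ) ↔
      ∃ c, Nat.beta c 0 ∈ a ∧ (∀ y < n, Nat.beta c (y + 1) ∈ s y (Nat.beta c y)) ∧
        Nat.beta c n = m := by
  constructor
  · intro h
    have key : ∀ n m, m ∈ (Nat.rec a (fun y IH => IH.bind (s y)) n : Part ℕ) →
        ∃ u : ℕ → ℕ, u 0 ∈ a ∧ (∀ y < n, u (y + 1) ∈ s y (u y)) ∧ u n = m := by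
      intro n
      induction n with
      | zero => exact fun m h => ⟨fun _ => m, h, by simp, rfl⟩
      | succ n ih =>
        intro m h
        obtain ⟨i, hi, hm⟩ := Part.mem_bind_iff.1 h
        obtain ⟨u, h0, hu, rfl⟩ := ih i hi
        refine ⟨Function.update u (n + 1) m, by simpa using h0, fun y hy => ?_, by simp⟩
        rcases Nat.lt_succ_iff_lt_or_eq.1 hy with hy | rfl
        · rw [Function.update_of_ne (by omega), Function.update_of_ne (by omega)]
          exact hu y hy
        · rw [Function.update_self, Function.update_of_ne (by omega)]
          exact hm
    obtain ⟨u, h0, hu, hm⟩ := key n m h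
    have hb (i : ℕ) (hi : i ≤ n) :
        Nat.beta (Nat.unbeta (List.ofFn fun i : Fin (n + 1) => u i)) i = u i := by
      have := Nat.beta_unbeta_coe (List.ofFn fun i : Fin (n + 1) => u i)
        ⟨i, by simpa using Nat.lt_succ_of_le hi⟩
      simpa [-List.ofFn_succ] using this
    refine ⟨_, (hb 0 (Nat.zero_le _)).symm ▸ h0, fun y hy => ?_, (hb n le_rfl).trans hm⟩
    rw [hb _ hy, hb _ hy.le]
    exact hu y hy
  · rintro ⟨c, h0, hs, rfl⟩
    induction n with
    | zero => exact h0
    | succ n ih =>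
      exact Part.mem_bind (ih fun y hy => hs y (Nat.lt_succ_of_lt hy)) (hs n n.lt_succ_self)

/-- The graph of a partial recursive function is defined by a bounded formula. -/
theorem SigmaDef.of_partrec {f : ℕ →. ℕ} (hf : Nat.Partrec f) :
    SigmaDef fun v : Fin 2 → ℕ => v 1 ∈ f (v 0) := by
  induction hf with
  | zero =>
    refine (SigmaDef.eq (.var (n := 2) 1) .zero).of_iff fun v => ?_
    exact Part.mem_some_iff
  | succ =>
    refine (SigmaDef.eq (.var (n := 2) 1) ((SigmaFun.var 0).add .one)).of_iff fun v => ?_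
    exact Part.mem_some_iff
  | left =>
    refine (SigmaDef.eq (.var (n := 2) 1) (SigmaFun.var 0).unpair_fst).of_iff fun v => ?_
    exact Part.mem_some_iff
  | right =>
    refine (SigmaDef.eq (.var (n := 2) 1) (SigmaFun.var 0).unpair_snd).of_iff fun v => ?_
    exact Part.mem_some_iff
  | @pair f g _ _ hf hg =>
    refine (SigmaDef.ex (Q := fun v x => ∃ y, x ∈ f (v 0) ∧ y ∈ g (v 0) ∧ v 1 = Nat.pair x y)
      (SigmaDef.ex (Q := fun w y => w 2 ∈ f (w 0) ∧ y ∈ g (w 0) ∧ w 1 = Nat.pair (w 2) y)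
        ((hf.comp₂ (r := fun x y => y ∈ f x) (.var (n := 4) 0) (.var 2)).and
          ((hg.comp₂ (r := fun x y => y ∈ g x) (.var (n := 4) 0) (.var 3)).and
            (SigmaDef.eq (.var 1) (.pair (.var 2) (.var 3))))))).of_iff fun v => ?_
    simp [Seq.seq, eq_comm]
  | @comp f g _ _ hf hg =>
    refine (SigmaDef.ex (Q := fun v x => x ∈ g (v 0) ∧ v 1 ∈ f x)
      ((hg.comp₂ (r := fun x y => y ∈ g x) (.var (n := 3) 0) (.var 2)).and
        (hf.comp₂ (r := fun x y => y ∈ f x) (.var (n := 3) 2) (.var 1)))).of_iff fun v => ?_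
    exact Part.mem_bind_iff
  | @prec f g _ _ hf hg =>
    refine (SigmaDef.ex (Q := fun v c => Nat.beta c 0 ∈ f (v 0).unpair.1 ∧
        (∀ y < (v 0).unpair.2, Nat.beta c (y + 1) ∈
          g (Nat.pair (v 0).unpair.1 (Nat.pair y (Nat.beta c y)))) ∧
        Nat.beta c (v 0).unpair.2 = v 1)
      ((hf.comp₂ (r := fun x y => y ∈ f x) (SigmaFun.var (n := 3) 0).unpair_fst
        (.beta (.var 2) .zero)).and
        ((SigmaDef.ball_lt (f := fun v : Fin 3 → ℕ => (v 0).unpair.2)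
          (Q := fun v y => Nat.beta (v 2) (y + 1) ∈
            g (Nat.pair (v 0).unpair.1 (Nat.pair y (Nat.beta (v 2) y))))
          (SigmaFun.var 0).unpair_snd
          (hg.comp₂ (r := fun x y => y ∈ g x)
            (.pair (SigmaFun.var (n := 4) 0).unpair_fst (.pair (.var 3) (.beta (.var 2) (.var 3))))
            (.beta (.var 2) (.add (.var 3) .one)))).and
        (SigmaDef.eq (.beta (.var 2) (SigmaFun.var 0).unpair_snd) (.var 1))))).of_iff fun v => ?_
    exact mem_rec_iff_beta (f (v 0).unpair.1)
      (fun y i => g (Nat.pair (v 0).unpair.1 (Nat.pair y i))) (v 0).unpair.2 (v 1)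
  | @rfind f _ hf =>
    refine ((hf.comp₂ (r := fun x y => y ∈ f x) (.pair (.var (n := 2) 0) (.var 1)) .zero).and
      (SigmaDef.ball_lt (f := fun v : Fin 2 → ℕ => v 1)
        (Q := fun v y => ∃ z, 0 < z ∧ z ∈ f (Nat.pair (v 0) y)) (.var 1)
        (SigmaDef.ex (Q := fun v z => 0 < z ∧ z ∈ f (Nat.pair (v 0) (v 2)))
          ((SigmaDef.lt .zero (.var (n := 4) 3)).and
            (hf.comp₂ (r := fun x y => y ∈ f x) (.pair (.var (n := 4) 0) (.var 2))
              (.var 3)))))).of_iff fun v => ?_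
    have e (y : ℕ) : false ∈ (fun m => decide (m = 0)) <$> f (Nat.pair (v 0) y) ↔
        ∃ z, 0 < z ∧ z ∈ f (Nat.pair (v 0) y) := by
      simp only [Part.map_eq_map, Part.mem_map_iff, decide_eq_false_iff_not, Nat.pos_iff_ne_zero,
        and_comm, ne_eq]
    refine Nat.mem_rfind.trans (and_congr (by simp) ?_)
    exact forall₂_congr fun y _ => e y

/-! ### Certified segments -/

section Certified

variable {M : Type} [arith.Structure M]

/-- A finite list of first-order conditions on the elements below `b`. They hold when `b` is the
value of a positive numeral in a model of `R`; and in an arbitrary structure they force the elements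
below `b` to start like the natural numbers. The last clauses on `+` and `×` say that the segment
contains the intermediate values of a recursive calculation if it contains its result. -/
def Certified (b : M) : Prop :=
  ltM (num M 0) b ∧ ∀ x y : M, ltM x b → ltM y b →
    (ltM (succM x) b ∨ succM x = b) ∧
    ¬ ltM x (num M 0) ∧
    (ltM y (succM x) ↔ ltM y x ∨ y = x) ∧
    ¬ ltM x x ∧
    addM x (num M 0) = x ∧
    (ltM (succM y) b → addM x (succM y) = succM (addM x y)) ∧
    (ltM (addM x (succM y)) b → ltM (addM x y) b) ∧
    mulM x (num M 0) = num M 0 ∧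
    (ltM (succM y) b → mulM x (succM y) = addM (mulM x y) x) ∧
    (ltM (mulM x (succM y)) b → ltM (mulM x y) b)

namespace Certified

variable {b : M} {k : ℕ}

theorem lt_num_iff (h : Certified b) (hk : ∀ i < k, ltM (num M i) b) {y : M} (hy : ltM y b)
    {j : ℕ} (hj : j ≤ k) : ltM y (num M j) ↔ ∃ i < j, y = num M i := by
  induction j with
  | zero => simpa using (h.2 y y hy hy).2.1
  | succ j ih =>
    refine (h.2 _ y (hk j hj) hy).2.2.1.trans ?_
    rw [ih (by omega)]
    constructor
    · rintro (⟨i, hi, rfl⟩ | rfl)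
      · exact ⟨i, by omega, rfl⟩
      · exact ⟨j, by omega, rfl⟩
    · rintro ⟨i, hi, rfl⟩
      rcases Nat.lt_succ_iff_lt_or_eq.1 hi with hi | rfl
      · exact Or.inl ⟨i, hi, rfl⟩
      · exact Or.inr rfl

theorem add_num (h : Certified b) (hk : ∀ i < k, ltM (num M i) b) (i j : ℕ) (hij : i + j < k) :
    addM (num M i) (num M j) = num M (i + j) := by
  induction j with
  | zero => exact (h.2 _ _ (hk i hij) (hk i hij)).2.2.2.2.1
  | succ j ih =>
    refine ((h.2 _ _ (hk i (by omega)) (hk j (by omega))).2.2.2.2.2.1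
      (hk (j + 1) (by omega))).trans ?_
    rw [ih (by omega)]
    rfl

theorem segment (h : Certified b) (hk : ∀ i < k, ltM (num M i) b) : Segment b k where
  lt_bound := hk
  lt i j hij hj := (h.lt_num_iff hk (hk i (hij.trans hj)) hj.le).2 ⟨i, hij, rfl⟩
  eq_num j hj y hy := (h.lt_num_iff hk hy hj.le).1
  add := h.add_num hk
  mul i j hi hj hij := by
    induction j with
    | zero => exact (h.2 _ _ (hk i hi) (hk i hi)).2.2.2.2.2.2.2.1
    | succ j ih =>
      rw [Nat.mul_succ] at hij
      refine ((h.2 _ _ (hk i hi) (hk j (by omega))).2.2.2.2.2.2.2.2.1 (hk (j + 1) hj)).trans ?_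
      rw [ih (by omega) (by omega), h.add_num hk _ _ hij, Nat.mul_succ]

theorem num_injective (h : Certified b) (hk : ∀ i < k, ltM (num M i) b) {i j : ℕ} (hi : i < k)
    (hj : j < k) (e : num M i = num M j) : i = j := by
  by_contra hne
  wlog hlt : i < j generalizing i j
  · exact this hj hi e.symm (Ne.symm hne) (by omega)
  have h1 := (h.segment hk).lt i j hlt hj
  rw [e] at h1
  exact (h.2 _ _ (hk j hj) (hk j hj)).2.2.2.1 h1

theorem add_of_lt (h : Certified b) (hk : ∀ i < k, ltM (num M i) b) (hb : ¬ ltM (num M k) b)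
    {i j : ℕ} (hi : i < k) (hj : j < k) (hij : ltM (addM (num M i) (num M j)) b) :
    i + j < k ∧ addM (num M i) (num M j) = num M (i + j) := by
  suffices i + j < k from ⟨this, (h.segment hk).add i j this⟩
  induction j with
  | zero => exact hi
  | succ j ih =>
    have hc := (h.2 _ _ (hk i hi) (hk j (by omega))).2.2.2.2.2
    have h1 := ih (by omega) (hc.2.1 hij)
    -- The sum is the successor of a numeral below `k`, and it is not the numeral of `k`.
    have h2 : addM (num M i) (num M (j + 1)) = num M (i + j + 1) :=
      (hc.1 (hk (j + 1) hj)).trans (congrArg succM ((h.segment hk).add i j h1))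
    rw [h2] at hij
    by_contra hlt
    obtain rfl : k = i + j + 1 := by omega
    exact hb hij

theorem mul_of_lt (h : Certified b) (hk : ∀ i < k, ltM (num M i) b) (hb : ¬ ltM (num M k) b)
    {i j : ℕ} (hi : i < k) (hj : j < k) (hij : ltM (mulM (num M i) (num M j)) b) :
    i * j < k ∧ mulM (num M i) (num M j) = num M (i * j) := by
  suffices i * j < k from ⟨this, (h.segment hk).mul i j hi hj this⟩
  induction j with
  | zero => simpa using hj
  | succ j ih =>
    have hc := (h.2 _ _ (hk i hi) (hk j (by omega))).2.2.2.2.2.2.2.2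
    have h1 := ih (by omega) (hc.2 hij)
    have h2 : mulM (num M i) (num M (j + 1)) = addM (num M (i * j)) (num M i) :=
      (hc.1 (hk (j + 1) hj)).trans
        (congrArg (addM · (num M i)) ((h.segment hk).mul i j hi (by omega) h1))
    rw [h2] at hij
    exact (h.add_of_lt hk hb h1 hi hij).1

theorem stdSegment (h : Certified b) (hk : ∀ i < k, ltM (num M i) b) (hb : ¬ ltM (num M k) b)
    (e : num M k = b) : StdSegment b k where
  toSegment := h.segment hk
  surj y hy := (h.lt_num_iff hk hy le_rfl).1 (e.symm ▸ hy)
  add_reflect i hi j hj l hl e := by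
    obtain ⟨h1, h2⟩ := h.add_of_lt hk hb hi hj (e ▸ hk l hl)
    exact h.num_injective hk h1 hl (h2.symm.trans e)
  mul_reflect i hi j hj l hl e := by
    obtain ⟨h1, h2⟩ := h.mul_of_lt hk hb hi hj (e ▸ hk l hl)
    exact h.num_injective hk h1 hl (h2.symm.trans e)
  lt_reflect i hi j hj hij := by
    obtain ⟨l, hl, e⟩ := (h.lt_num_iff hk (hk i hi) hj.le).1 hij
    rwa [h.num_injective hk hi (hl.trans hj) e]

/-- A certified segment is either at least as long as any given standard one or standard itself. -/
theorem segment_or_stdSegment (h : Certified b) (m : ℕ) :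
    Segment b m ∨ ∃ k, StdSegment b k ∧ ¬ ltM (num M k) b := by
  classical
  by_cases hm : ∀ i < m, ltM (num M i) b
  · exact Or.inl (h.segment hm)
  · push Not at hm
    have hex : ∃ k, ¬ ltM (num M k) b := hm.imp fun _ h => h.2
    have hb := Nat.find_spec hex
    have hk : ∀ i < Nat.find hex, ltM (num M i) b := fun i hi => not_not.1 (Nat.find_min hex hi)
    refine Or.inr ⟨Nat.find hex, h.stdSegment hk hb ?_, hb⟩
    obtain ⟨k, e⟩ : ∃ k, Nat.find hex = k + 1 :=
      Nat.exists_eq_succ_of_ne_zero fun e => hb (e.symm ▸ h.1)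
    rw [e] at hb hk ⊢
    have hlt := hk k (by omega)
    exact (h.2 _ _ hlt hlt).1.resolve_left hb

end Certified

/-- The formula that expresses `Certified b`, where `b` is the variable of type `Unit`. The variable
with index `0` does not occur in it. -/
def certifiedF : arith.BoundedFormula Unit 1 :=
  let b {n : ℕ} : arith.Term (Unit ⊕ Fin n) := Term.var (Sum.inl ())
  let x : arith.Term (Unit ⊕ Fin 3) := Term.var (Sum.inr 1)
  let y : arith.Term (Unit ⊕ Fin 3) := Term.var (Sum.inr 2)
  ltB (numeral 0) b ⊓
    ((ltB x b).imp ((ltB y b).imp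
      ((ltB (succT x) b ⊔ (succT x).bdEqual b) ⊓
      ((ltB x (numeral 0)).not ⊓
      (((ltB y (succT x)).iff (ltB y x ⊔ y.bdEqual x)) ⊓
      ((ltB x x).not ⊓
      ((addT x (numeral 0)).bdEqual x ⊓
      (((ltB (succT y) b).imp ((addT x (succT y)).bdEqual (succT (addT x y)))) ⊓
      (((ltB (addT x (succT y)) b).imp (ltB (addT x y) b)) ⊓
      ((mulT x (numeral 0)).bdEqual (numeral 0) ⊓
      (((ltB (succT y) b).imp ((mulT x (succT y)).bdEqual (addT (mulT x y) x))) ⊓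
      ((ltB (mulT x (succT y)) b).imp (ltB (mulT x y) b))))))))))))).all.all

theorem realize_certifiedF (b : M) (xs : Fin 1 → M) :
    certifiedF.Realize (fun _ => b) xs ↔ Certified b := by
  have h1 (x y : M) : (Fin.snoc (Fin.snoc xs x : Fin 2 → M) y : Fin 3 → M) 1 = x := rfl
  have h2 (x y : M) : (Fin.snoc (Fin.snoc xs x : Fin 2 → M) y : Fin 3 → M) 2 = y := rfl
  simp only [certifiedF, Certified, BoundedFormula.realize_inf, BoundedFormula.realize_all,
    BoundedFormula.realize_imp, BoundedFormula.realize_sup, BoundedFormula.realize_not,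
    BoundedFormula.realize_iff, BoundedFormula.realize_bdEqual, realize_ltB, realize_addT,
    realize_mulT, realize_succT, realize_numeral, Term.realize_var, Sum.elim_inl, Sum.elim_inr,
    h1, h2]

end Certified

/-! ### Models of `R` -/

theorem realize_eqNumeralBelow {M : Type} [arith.Structure M] {m : ℕ}
    (t : arith.Term (Empty ⊕ Fin m)) (n : ℕ) (v : Empty → M) (xs : Fin m → M) :
    (eqNumeralBelow t n).Realize v xs ↔ ∃ i < n, t.realize (Sum.elim v xs) = num M i := by
  induction n with
  | zero => simp [eqNumeralBelow]
  | succ n ih =>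
    simp only [eqNumeralBelow, BoundedFormula.realize_sup, ih, BoundedFormula.realize_bdEqual,
      realize_numeral, Nat.lt_succ_iff_lt_or_eq]
    constructor
    · rintro (⟨i, hi, h⟩ | h)
      · exact ⟨i, Or.inl hi, h⟩
      · exact ⟨n, Or.inr rfl, h⟩
    · rintro ⟨i, hi | rfl, h⟩
      · exact Or.inl ⟨i, hi, h⟩
      · exact Or.inr h

section ModelsR

variable (M : Type) [arith.Structure M]

theorem models_R_iff : M ⊨ R ↔
    (∀ m n, addM (num M m) (num M n) = num M (m + n)) ∧
    (∀ m n, mulM (num M m) (num M n) = num M (m * n)) ∧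
    (∀ m n, m ≠ n → num M m ≠ num M n) ∧
    (∀ n, ∀ x : M, ltM x (num M n) → ∃ i < n, x = num M i) ∧
    (∀ n, ∀ x : M, ltM x (num M n) ∨ x = num M n ∨ ltM (num M n) x) := by
  have h1 (m n : ℕ) : M ⊨ axR1 m n ↔ addM (num M m) (num M n) = num M (m + n) := by
    simp [axR1, Sentence.Realize, Formula.Realize]
  have h2 (m n : ℕ) : M ⊨ axR2 m n ↔ mulM (num M m) (num M n) = num M (m * n) := by
    simp [axR2, Sentence.Realize, Formula.Realize]
  have h3 (m n : ℕ) : M ⊨ axR3 m n ↔ num M m ≠ num M n := by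
    simp [axR3, Sentence.Realize, Formula.Realize]
  have h4 (n : ℕ) : M ⊨ axR4 n ↔ ∀ x : M, ltM x (num M n) → ∃ i < n, x = num M i := by
    simp only [axR4, Sentence.Realize, Formula.Realize, BoundedFormula.realize_all,
      BoundedFormula.realize_imp, realize_ltF, realize_eqNumeralBelow, realize_numeral]
    rfl
  have h5 (n : ℕ) : M ⊨ axR5 n ↔
      ∀ x : M, ltM x (num M n) ∨ x = num M n ∨ ltM (num M n) x := by
    simp only [axR5, Sentence.Realize, Formula.Realize, BoundedFormula.realize_all,
      BoundedFormula.realize_sup, BoundedFormula.realize_bdEqual, realize_ltF, realize_numeral]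
    rfl
  simp only [Theory.model_iff, R, Set.mem_ofPred_eq, ← h1, ← h2, ← h3, ← h4, ← h5]
  constructor
  · intro h
    exact ⟨fun m n => h _ (Or.inl ⟨m, n, rfl⟩), fun m n => h _ (Or.inr (Or.inl ⟨m, n, rfl⟩)),
      fun m n hmn => h _ (Or.inr (Or.inr (Or.inl ⟨m, n, hmn, rfl⟩))),
      fun n => h _ (Or.inr (Or.inr (Or.inr (Or.inl ⟨n, rfl⟩)))),
      fun n => h _ (Or.inr (Or.inr (Or.inr (Or.inr ⟨n, rfl⟩))))⟩
  · rintro ⟨h1, h2, h3, h4, h5⟩ φ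
      (⟨m, n, rfl⟩ | ⟨m, n, rfl⟩ | ⟨m, n, hmn, rfl⟩ | ⟨n, rfl⟩ | ⟨n, rfl⟩)
    exacts [h1 m n, h2 m n, h3 m n hmn, h4 n, h5 n]

variable {M}

theorem lt_num_iff_of_models_R (h : M ⊨ R) (n : ℕ) (x : M) :
    ltM x (num M n) ↔ ∃ i < n, x = num M i := by
  obtain ⟨-, -, h3, h4, h5⟩ := (models_R_iff M).1 h
  refine ⟨h4 n x, ?_⟩
  rintro ⟨i, hi, rfl⟩
  rcases h5 n (num M i) with hlt | e | hlt
  · exact hlt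
  · exact absurd e (h3 i n hi.ne)
  · obtain ⟨j, hj, e⟩ := h4 i _ hlt
    exact absurd e (h3 n j (by omega))

theorem num_lt_num_iff_of_models_R (h : M ⊨ R) (i n : ℕ) :
    ltM (num M i) (num M n) ↔ i < n := by
  rw [lt_num_iff_of_models_R h]
  obtain ⟨-, -, h3, -, -⟩ := (models_R_iff M).1 h
  constructor
  · rintro ⟨j, hj, e⟩
    obtain rfl : i = j := by_contra fun hne => h3 i j hne e
    exact hj
  · exact fun hi => ⟨i, hi, rfl⟩

theorem certified_num_of_models_R (h : M ⊨ R) {k : ℕ} (hk : 0 < k) : Certified (num M k) := by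
  obtain ⟨h1, h2, h3, -, -⟩ := (models_R_iff M).1 h
  have hinj (i j : ℕ) : num M i = num M j ↔ i = j :=
    ⟨fun e => by_contra fun hne => h3 i j hne e, fun e => e ▸ rfl⟩
  have hlt := num_lt_num_iff_of_models_R h
  have hs (i : ℕ) : succM (num M i) = num M (i + 1) := rfl
  refine ⟨(hlt _ _).2 hk, fun x y hx hy => ?_⟩
  obtain ⟨i, hi, rfl⟩ := (lt_num_iff_of_models_R h k x).1 hx
  obtain ⟨j, hj, rfl⟩ := (lt_num_iff_of_models_R h k y).1 hy
  simp only [hs, h1, h2, hlt, hinj, Nat.mul_succ]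
  refine ⟨?_, ?_, ?_, ?_, ?_, ?_, ?_, ?_, ?_, ?_⟩ <;>
    first | exact fun _ => trivial | omega

theorem stdSegment_num_of_models_R (h : M ⊨ R) {k : ℕ} (hk : 0 < k) : StdSegment (num M k) k :=
  (certified_num_of_models_R h hk).stdSegment
    (fun i hi => (num_lt_num_iff_of_models_R h i k).2 hi)
    (fun hlt => absurd ((num_lt_num_iff_of_models_R h k k).1 hlt) (lt_irrefl k)) rfl

end ModelsR

/-- The standard model. -/
instance instStructureNat : arith.Structure ℕ where
  funMap := fun {_} f => match f with
    | ArithFunc.zero => fun _ => 0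
    | ArithFunc.succ => fun x => x 0 + 1
    | ArithFunc.add => fun x => x 0 + x 1
    | ArithFunc.mul => fun x => x 0 * x 1
  RelMap := fun {_} r => match r with
    | ArithRel.lt => fun x => x 0 < x 1

theorem num_nat (n : ℕ) : num ℕ n = n := by
  induction n with
  | zero => rfl
  | succ n ih => exact congrArg (· + 1) ih

theorem nat_models_R : ℕ ⊨ R := by
  have ha (x y : ℕ) : addM x y = x + y := rfl
  have hm (x y : ℕ) : mulM x y = x * y := rfl
  have hl (x y : ℕ) : ltM x y ↔ x < y := Iff.rfl
  rw [models_R_iff]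
  simp only [num_nat, ha, hm, hl]
  refine ⟨fun _ _ => trivial, fun _ _ => trivial, fun _ _ h => h, fun n x h => ⟨x, h, rfl⟩,
    fun n x => by omega⟩

theorem consistent_of_model {T : arith.Theory} (M : Type) [arith.Structure M] [Nonempty M]
    (h : M ⊨ T) : Consistent T :=
  fun hT => hT (Theory.ModelType.of T M) default default

theorem nonempty_modelType_of_consistent {T : arith.Theory} (h : Consistent T) :
    Nonempty (Theory.ModelType.{0, 0, 0} T) := by
  by_contra hT
  exact h fun M => absurd ⟨M⟩ hT

/-! ### Sentences that separate the values `0` and `1` of a partial recursive function -/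

/-- The formula `0 < b → ⋯ → n - 1 < b → φ`, on numerals, where `b` is the first variable. -/
def guard (φ : arith.BoundedFormula Empty 2) : ℕ → arith.BoundedFormula Empty 2
  | 0 => φ
  | n + 1 => (ltF (numeral n) (Term.var (Sum.inr 0))).imp (guard φ n)

theorem realize_guard {M : Type} [arith.Structure M] (φ : arith.BoundedFormula Empty 2) (n : ℕ)
    (v : Empty → M) (xs : Fin 2 → M) :
    (guard φ n).Realize v xs ↔ (∀ i < n, ltM (num M i) (xs 0)) → φ.Realize v xs := by
  induction n with
  | zero => simp [guard]
  | succ n ih =>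
    simp only [guard, BoundedFormula.realize_imp, ih, realize_ltF, realize_numeral,
      Term.realize_var, Sum.elim_inr, Nat.lt_succ_iff_lt_or_eq]
    constructor
    · exact fun h h' => h (h' n (Or.inr rfl)) fun i hi => h' i (Or.inl hi)
    · rintro h hn h'
      refine h fun i hi => ?_
      rcases hi with hi | rfl
      exacts [h' i hi, hn]

/-- The sentence `∀ b y, 0 < b → ⋯ → n < b → y = n → θ(b, y)`, on numerals. The bounds for all
numbers up to `n` are needed because the numeral of a large number may take a small value in a
structure that is not a model of `R`. -/
def sepSentence (θ : arith.BoundedFormula Empty 2) (n : ℕ) : arith.Sentence :=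
  (guard ((Term.bdEqual (Term.var (Sum.inr 1)) (numeral n)).imp θ) (n + 1)).all.all

theorem realize_sepSentence {M : Type} [arith.Structure M] (θ : arith.BoundedFormula Empty 2)
    (n : ℕ) : M ⊨ sepSentence θ n ↔
      ∀ b : M, (∀ i ≤ n, ltM (num M i) b) → θ.Realize default ![b, num M n] := by
  have h (b y : M) : (Fin.snoc (Fin.snoc default b : Fin 1 → M) y : Fin 2 → M) = ![b, y] := by
    funext i
    fin_cases i <;> rfl
  simp only [sepSentence, Sentence.Realize, Formula.Realize, BoundedFormula.realize_all,
    realize_guard, h, BoundedFormula.realize_imp, BoundedFormula.realize_bdEqual, Term.realize_var,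
    Sum.elim_inr, realize_numeral, Nat.lt_succ_iff]
  constructor
  · exact fun h b hb => h b _ hb rfl
  · rintro h b y hb rfl
    exact h b hb

/-- The sentence for `n` says that no certified `b` above `n` bounds a computation of the value `0`
at `n` but no computation of the value `1`. -/
theorem exists_sepSentence {f : ℕ →. ℕ} (hf : Nat.Partrec f) :
    ∃ θ : arith.BoundedFormula Empty 2,
      (∀ n, 1 ∈ f n → ∀ (M : Type) [arith.Structure M], M ⊨ sepSentence θ n) ∧
      (∀ n, 0 ∈ f n → ∀ (M : Type) [arith.Structure M], M ⊨ R → ¬ M ⊨ sepSentence θ n) := by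
  have hA : SigmaDef fun v : Fin 1 → ℕ => 0 ∈ f (v 0) :=
    (SigmaDef.of_partrec hf).comp₂ (r := fun x y => y ∈ f x) (.var 0) .zero
  have hB : SigmaDef fun v : Fin 1 → ℕ => 1 ∈ f (v 0) :=
    (SigmaDef.of_partrec hf).comp₂ (r := fun x y => y ∈ f x) (.var 0) .one
  obtain ⟨α, hα, hα'⟩ := hA
  obtain ⟨β, hβ, hβ'⟩ := hB
  let θ : arith.BoundedFormula Empty 2 :=
    BoundedFormula.relabel (n := 1) (k := 1) (fun _ => Sum.inr 0) (certifiedF ⊓ (α ⊓ β.not)).not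
  have hθ (M : Type) [arith.Structure M] (b : M) (n : ℕ) :
      θ.Realize default ![b, num M n] ↔ ¬ (Certified b ∧
        α.Realize (fun _ => b) (num M ∘ fun _ => n) ∧
        ¬ β.Realize (fun _ => b) (num M ∘ fun _ => n)) := by
    have h1 : ((![b, num M n] : Fin 2 → M) ∘ Fin.natAdd 1 : Fin 1 → M) = num M ∘ fun _ => n := by
      funext i
      fin_cases i
      rfl
    refine (BoundedFormula.realize_relabel (m := 1) (n := 1) (xs := ![b, num M n])).trans ?_
    rw [h1, BoundedFormula.realize_not, BoundedFormula.realize_inf, BoundedFormula.realize_inf,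
      BoundedFormula.realize_not]
    exact not_congr (and_congr (realize_certifiedF b _) Iff.rfl)
  refine ⟨θ, fun n hn M _ => ?_, fun n hn M _ hM h => ?_⟩
  · rw [realize_sepSentence]
    refine fun b hb => (hθ M b n).2 fun ⟨hc, h0, h1⟩ => ?_
    obtain ⟨k, hk⟩ := hβ (fun _ => n) hn
    rcases hc.segment_or_stdSegment k with hs | ⟨j, hs, hj⟩
    · exact h1 (hk M b hs)
    · have hnj : n < j := by
        by_contra hnj
        exact hj (hb j (not_lt.1 hnj))
      have h01 := Part.mem_unique (hα' M b j hs _ (fun _ => hnj) h0) hn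
      exact absurd h01 zero_ne_one
  · rw [realize_sepSentence] at h
    obtain ⟨k, hk⟩ := hα (fun _ => n) hn
    have hs := stdSegment_num_of_models_R hM (k := max k (n + 1)) (by omega)
    refine (hθ M _ n).1 (h (num M (max k (n + 1))) fun i hi =>
      (num_lt_num_iff_of_models_R hM _ _).2 (by omega)) ⟨certified_num_of_models_R hM (by omega),
        hk M _ (hs.toSegment.mono (le_max_left _ _)), fun h1 => ?_⟩
    have h01 := Part.mem_unique hn (hβ' M _ _ hs _ (fun _ => by omega) h1)
    exact absurd h01 zero_ne_one

/-! ### Computability of Gödel numbers -/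

section Codes

/-- The Gödel number of `t = u`, from those of `t` and `u`. -/
def eqCode (a b : ℕ) : ℕ := 4 * Nat.pair a b + 1

/-- The Gödel number of an implication. -/
def impCode (a b : ℕ) : ℕ := 4 * Nat.pair a b + 3

/-- The Gödel number of a universal quantification. -/
def allCode (a : ℕ) : ℕ := 4 * a + 4

/-- The Gödel number of a disjunction, which abbreviates an implication from a negation. -/
def orCode (a b : ℕ) : ℕ := impCode (impCode a 0) b

/-- The Gödel number of `t < u`. -/
def ltCode (a b : ℕ) : ℕ := 4 * Nat.pair 2 (Nat.pair 0 (Encodable.encode [a, b])) + 2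

/-- The Gödel number of `f(t, u)`, for the binary function symbol with number `i`. -/
def binCode (i a b : ℕ) : ℕ := 2 * Nat.pair 2 (Nat.pair i (Encodable.encode [a, b])) + 1

/-- The Gödel number of a numeral. -/
def numCode : ℕ → ℕ
  | 0 => 1
  | n + 1 => 2 * Nat.pair 1 (Nat.pair 0 (Encodable.encode [numCode n])) + 1

/-- The Gödel number of `eqNumeralBelow`, for a term with Gödel number `a`. -/
def eqBelowCode (a : ℕ) : ℕ → ℕ
  | 0 => 0
  | n + 1 => orCode (eqBelowCode a n) (eqCode a (numCode n))

variable {m : ℕ}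

theorem formulaCode_bdEqual (t u : arith.Term (Empty ⊕ Fin m)) :
    formulaCode (t.bdEqual u) = eqCode (termCode t) (termCode u) :=
  rfl

theorem formulaCode_imp (φ ψ : arith.BoundedFormula Empty m) :
    formulaCode (φ.imp ψ) = impCode (formulaCode φ) (formulaCode ψ) :=
  rfl

theorem formulaCode_not (φ : arith.BoundedFormula Empty m) :
    formulaCode φ.not = impCode (formulaCode φ) 0 :=
  rfl

theorem formulaCode_sup (φ ψ : arith.BoundedFormula Empty m) :
    formulaCode (φ ⊔ ψ) = orCode (formulaCode φ) (formulaCode ψ) :=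
  rfl

theorem formulaCode_all (φ : arith.BoundedFormula Empty (m + 1)) :
    formulaCode φ.all = allCode (formulaCode φ) :=
  rfl

theorem formulaCode_ltF (t u : arith.Term (Empty ⊕ Fin m)) :
    formulaCode (ltF t u) = ltCode (termCode t) (termCode u) := by
  simp [ltF, Relations.boundedFormula₂, Relations.boundedFormula, formulaCode, ltCode]
  rfl

theorem termCode_addT (t u : arith.Term (Empty ⊕ Fin m)) :
    termCode (addT t u) = binCode 0 (termCode t) (termCode u) := by
  simp [addT, Functions.apply₂, termCode, binCode]
  rfl

theorem termCode_mulT (t u : arith.Term (Empty ⊕ Fin m)) :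
    termCode (mulT t u) = binCode 1 (termCode t) (termCode u) := by
  simp [mulT, Functions.apply₂, termCode, binCode]
  rfl

theorem termCode_numeral (n : ℕ) :
    termCode (numeral n : arith.Term (Empty ⊕ Fin m)) = numCode n := by
  induction n with
  | zero => rfl
  | succ n ih =>
    rw [numCode, ← ih]
    rfl

theorem formulaCode_eqNumeralBelow (t : arith.Term (Empty ⊕ Fin m)) (n : ℕ) :
    formulaCode (eqNumeralBelow t n) = eqBelowCode (termCode t) n := by
  induction n with
  | zero => rfl
  | succ n ih =>
    rw [eqNumeralBelow, formulaCode_sup, ih, formulaCode_bdEqual, termCode_numeral, eqBelowCode]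

theorem formulaCode_guard (φ : arith.BoundedFormula Empty 2) (n : ℕ) :
    formulaCode (guard φ n) =
      Nat.rec (formulaCode φ) (fun i a => impCode (ltCode (numCode i) 0) a) n := by
  induction n with
  | zero => rfl
  | succ n ih =>
    rw [guard, formulaCode_imp, ih, formulaCode_ltF, termCode_numeral]
    rfl

theorem formulaCode_sepSentence (θ : arith.BoundedFormula Empty 2) (n : ℕ) :
    formulaCode (sepSentence θ n) = allCode (allCode
      (Nat.rec (impCode (eqCode 2 (numCode n)) (formulaCode θ))
        (fun i a => impCode (ltCode (numCode i) 0) a) (n + 1))) := by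
  rw [sepSentence, formulaCode_all, formulaCode_all, formulaCode_guard, formulaCode_imp,
    formulaCode_bdEqual, termCode_numeral]
  rfl

variable {α : Type*} [Primcodable α] {f g : α → ℕ}

theorem primrec_eqCode (hf : Primrec f) (hg : Primrec g) :
    Primrec fun a => eqCode (f a) (g a) :=
  Primrec.nat_add.comp (Primrec.nat_mul.comp (.const 4) (Primrec₂.natPair.comp hf hg)) (.const 1)

theorem primrec_impCode (hf : Primrec f) (hg : Primrec g) :
    Primrec fun a => impCode (f a) (g a) :=
  Primrec.nat_add.comp (Primrec.nat_mul.comp (.const 4) (Primrec₂.natPair.comp hf hg)) (.const 3)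

theorem primrec_allCode (hf : Primrec f) : Primrec fun a => allCode (f a) :=
  Primrec.nat_add.comp (Primrec.nat_mul.comp (.const 4) hf) (.const 4)

theorem primrec_orCode (hf : Primrec f) (hg : Primrec g) :
    Primrec fun a => orCode (f a) (g a) :=
  primrec_impCode (primrec_impCode hf (.const 0)) hg

theorem primrec_encode_pair (hf : Primrec f) (hg : Primrec g) :
    Primrec fun a => Encodable.encode [f a, g a] :=
  Primrec.encode.comp (Primrec.list_cons.comp hf (Primrec.list_cons.comp hg (.const [])))

theorem primrec_ltCode (hf : Primrec f) (hg : Primrec g) :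
    Primrec fun a => ltCode (f a) (g a) :=
  Primrec.nat_add.comp (Primrec.nat_mul.comp (.const 4) (Primrec₂.natPair.comp (.const 2)
    (Primrec₂.natPair.comp (.const 0) (primrec_encode_pair hf hg)))) (.const 2)

theorem primrec_binCode (i : ℕ) (hf : Primrec f) (hg : Primrec g) :
    Primrec fun a => binCode i (f a) (g a) :=
  Primrec.nat_add.comp (Primrec.nat_mul.comp (.const 2) (Primrec₂.natPair.comp (.const 2)
    (Primrec₂.natPair.comp (.const i) (primrec_encode_pair hf hg)))) (.const 1)

theorem primrec_numCode : Primrec numCode := by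
  have h : Primrec fun a : ℕ => 2 * Nat.pair 1 (Nat.pair 0 (Encodable.encode [a])) + 1 :=
    Primrec.nat_add.comp (Primrec.nat_mul.comp (.const 2) (Primrec₂.natPair.comp (.const 1)
      (Primrec₂.natPair.comp (.const 0)
        (Primrec.encode.comp (Primrec.list_cons.comp .id (.const [])))))) (.const 1)
  refine (Primrec.nat_rec₁ 1 (h.comp₂ Primrec₂.right)).of_eq fun n => ?_
  induction n with
  | zero => rfl
  | succ n ih =>
    exact congrArg (fun a : ℕ => 2 * Nat.pair 1 (Nat.pair 0 (Encodable.encode [a])) + 1) ih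

theorem primrec_eqBelowCode (a : ℕ) : Primrec (eqBelowCode a) := by
  refine (Primrec.nat_rec₁ (f := fun n c => orCode c (eqCode a (numCode n))) 0
    (primrec_orCode Primrec.snd
      (primrec_eqCode (.const a) (primrec_numCode.comp Primrec.fst)))).of_eq fun n => ?_
  induction n with
  | zero => rfl
  | succ n ih => exact congrArg (fun c => orCode c (eqCode a (numCode n))) ih

theorem primrec_formulaCode_sepSentence (θ : arith.BoundedFormula Empty 2) :
    Primrec fun n => formulaCode (sepSentence θ n) := by
  simp only [formulaCode_sepSentence]
  refine primrec_allCode (primrec_allCode (Primrec.nat_rec'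
    (h := fun _ p => impCode (ltCode (numCode p.1) 0) p.2) Primrec.succ
    (primrec_impCode (primrec_eqCode (.const 2) primrec_numCode) (.const _)) ?_))
  have hp : Primrec fun p : ℕ × ℕ × ℕ => p.2 := Primrec.snd
  exact primrec_impCode (primrec_ltCode (primrec_numCode.comp (Primrec.fst.comp hp)) (.const 0))
    (Primrec.snd.comp hp)

end Codes

theorem rePred_exists {α : Type*} [Primcodable α] {p : α → ℕ → Prop}
    (h : PrimrecPred fun x : α × ℕ => p x.1 x.2) : REPred fun a => ∃ n, p a n := by
  obtain ⟨hdec, h⟩ := h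
  have hd : Computable₂ fun (a : α) (n : ℕ) => @decide (p a n) (hdec (a, n)) := h.to_comp
  refine (Partrec.dom_re (Partrec.rfind hd.partrec₂)).of_eq fun a => Nat.rfind_dom.trans ?_
  refine exists_congr fun n => (and_iff_left fun {_} _ => trivial).trans ?_
  exact Part.mem_some_iff.trans (eq_comm.trans (@decide_eq_true_iff _ (hdec (a, n))))

theorem re_R : RE R := by
  refine (rePred_exists (p := fun c p =>
      c = formulaCode (axR1 p.unpair.1 p.unpair.2) ∨
      c = formulaCode (axR2 p.unpair.1 p.unpair.2) ∨
      (p.unpair.1 ≠ p.unpair.2 ∧ c = formulaCode (axR3 p.unpair.1 p.unpair.2)) ∨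
      c = formulaCode (axR4 p) ∨ c = formulaCode (axR5 p)) ?_).of_eq fun c => ?_
  · simp only [axR1, axR2, axR3, axR4, axR5, formulaCode_bdEqual, formulaCode_not,
      formulaCode_all, formulaCode_imp, formulaCode_sup, formulaCode_ltF, termCode_addT,
      termCode_mulT, termCode_numeral, formulaCode_eqNumeralBelow]
    have hl : Primrec fun x : ℕ × ℕ => x.2.unpair.1 :=
      Primrec.fst.comp (Primrec.unpair.comp Primrec.snd)
    have hr : Primrec fun x : ℕ × ℕ => x.2.unpair.2 :=
      Primrec.snd.comp (Primrec.unpair.comp Primrec.snd)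
    have hn : Primrec fun x : ℕ × ℕ => numCode x.2 := primrec_numCode.comp Primrec.snd
    have hnl := primrec_numCode.comp hl
    have hnr := primrec_numCode.comp hr
    refine (Primrec.eq.comp Primrec.fst (primrec_eqCode (primrec_binCode 0 hnl hnr)
      (primrec_numCode.comp (Primrec.nat_add.comp hl hr)))).or <|
      (Primrec.eq.comp Primrec.fst (primrec_eqCode (primrec_binCode 1 hnl hnr)
      (primrec_numCode.comp (Primrec.nat_mul.comp hl hr)))).or <|
      ((Primrec.eq.comp hl hr).not.and (Primrec.eq.comp Primrec.fst
        (primrec_impCode (primrec_eqCode hnl hnr) (.const 0)))).or <|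
      (Primrec.eq.comp Primrec.fst (primrec_allCode (primrec_impCode
        (primrec_ltCode (.const _) hn) ((primrec_eqBelowCode _).comp Primrec.snd)))).or <|
      Primrec.eq.comp Primrec.fst (primrec_allCode (primrec_orCode
        (primrec_ltCode (.const _) hn) (primrec_orCode (primrec_eqCode (.const _) hn)
          (primrec_ltCode hn (.const _)))))
  · constructor
    · rintro ⟨p, h | h | ⟨hne, h⟩ | h | h⟩
      · exact ⟨_, Or.inl ⟨_, _, rfl⟩, h.symm⟩
      · exact ⟨_, Or.inr (Or.inl ⟨_, _, rfl⟩), h.symm⟩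
      · exact ⟨_, Or.inr (Or.inr (Or.inl ⟨_, _, hne, rfl⟩)), h.symm⟩
      · exact ⟨_, Or.inr (Or.inr (Or.inr (Or.inl ⟨_, rfl⟩))), h.symm⟩
      · exact ⟨_, Or.inr (Or.inr (Or.inr (Or.inr ⟨_, rfl⟩))), h.symm⟩
    · rintro ⟨_, ⟨m, n, rfl⟩ | ⟨m, n, rfl⟩ | ⟨m, n, hne, rfl⟩ | ⟨n, rfl⟩ | ⟨n, rfl⟩, rfl⟩
      · exact ⟨Nat.pair m n, by simp⟩
      · exact ⟨Nat.pair m n, by simp⟩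
      · exact ⟨Nat.pair m n, by simp [hne]⟩
      · exact ⟨n, by simp⟩
      · exact ⟨n, by simp⟩

/-! ### Recursive inseparability and the theorem of Cobham -/

/-- There is a partial recursive function whose preimages of `0` and `1` are not separated by any
recursive set: on the number of a program, it runs the program on that number. -/
theorem exists_partrec_inseparable : ∃ f : ℕ →. ℕ, Nat.Partrec f ∧ ∀ p : ℕ → Prop,
    ComputablePred p → (∀ n, 1 ∈ f n → p n) → ∃ n, 0 ∈ f n ∧ p n := by
  refine ⟨fun n => Nat.Partrec.Code.eval (Denumerable.ofNat _ n) n, ?_, fun p hp h1 => ?_⟩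
  · exact Partrec.nat_iff.1
      (Nat.Partrec.Code.eval_part.comp (Computable.ofNat Nat.Partrec.Code) Computable.id)
  · obtain ⟨_, hp⟩ := hp
    have hg : Computable fun n => bif decide (p n) then 0 else 1 :=
      Computable.cond hp (Computable.const 0) (Computable.const 1)
    obtain ⟨c, hc⟩ := Nat.Partrec.Code.exists_code.1 (Partrec.nat_iff.1 hg.partrec)
    have he : Nat.Partrec.Code.eval c (Encodable.encode c) =
        Part.some (bif decide (p (Encodable.encode c)) then 0 else 1) := by
      rw [hc]
      rfl
    refine ⟨Encodable.encode c, ?_⟩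
    have h1 := h1 (Encodable.encode c)
    simp only [Denumerable.ofNat_encode, he] at h1 ⊢
    by_cases hpc : p (Encodable.encode c)
    · simp [hpc]
    · simp [hpc] at h1

theorem undecidable_of_subTheory {V W : arith.Theory} (hV : Consistent V) (hR : SubTheory R V)
    (hW : SubTheory W V) : Undecidable W := by
  intro hdec
  obtain ⟨f, hf, hsep⟩ := exists_partrec_inseparable
  obtain ⟨θ, h1, h0⟩ := exists_sepSentence hf
  have hp : ComputablePred fun n => sepSentence θ n ∈ theoremsOf W := by
    obtain ⟨_, hdec⟩ := hdec
    refine ComputablePred.of_eq ⟨_, hdec.comp (primrec_formulaCode_sepSentence θ).to_comp⟩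
      fun n => ?_
    constructor
    · rintro ⟨φ, hφ, e⟩
      exact formulaCode_injective e ▸ hφ
    · exact fun h => ⟨_, h, rfl⟩
  obtain ⟨n, hn, hmem⟩ := hsep _ hp fun n hn M v xs => by
    rw [Subsingleton.elim v default, Subsingleton.elim xs default]
    exact h1 n hn M
  obtain ⟨M⟩ := nonempty_modelType_of_consistent hV
  refine h0 n hn M ?_ (hW hmem M default default)
  refine (Theory.model_iff _).2 fun φ hφ => ?_
  exact hR (fun N v xs => by
    rw [Subsingleton.elim v default, Subsingleton.elim xs default]
    exact N.is_model.realize_of_mem φ hφ) M default default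

end CobhamR

theorem mainTheorem5 :
    CobhamR.RE CobhamR.R ∧ CobhamR.Consistent CobhamR.R ∧
      CobhamR.Essentially (CobhamR.Hereditarily CobhamR.Undecidable) CobhamR.R :=
  ⟨CobhamR.re_R, CobhamR.consistent_of_model ℕ CobhamR.nat_models_R,
    fun _ _ hV hR _ _ _ hW => CobhamR.undecidable_of_subTheory hV hR hW⟩
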